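/- Let $X$ be a Tychonoff (completely regular $T_1$) space and let $C(X)$ be the vector lattice of all continuous real-valued functions on $X$, with pointwise order. For $x\in X$ let $\delta_x : C(X)\to\mathbb{R}$, $\delta_x(f)=f(x)$. Let $C(X)^\sim$ be the order dual of $C(X)$, i.e. the space of all linear functionals $\varphi : C(X)\to\mathbb{R}$ that are bounded on every order interval $[a,b]\subseteq C(X)$, and let $C(X)^\sim_c$ be the $\sigma$-order continuous dual, i.e. the space of all $\varphi\in C(X)^\sim$ such that $\varphi(u_n)\to 0$ whenever the sequence $(u_n)$ converges in order to $0$ (that is, $|u_n|\le y_n$ for all $n$ and some sequence $y_n\downarrow 0$ in $C(X)$). Let $c_{00}(X)$ be the space of finitely supported functions $a : X\to\mathbb{R}$. Assume that $X$ is a P-space, i.e. every intersection of countably many open subsets of $X$ is open. Then: (1) $\delta_x\in C(X)^\sim_c$ for every $x\in X$. (2) If, in addition, $X$ is realcompact (that is, for every Tychonoff space $Y$ containing $X$ as a proper dense subspace, the restriction map $C(Y)\to C(X)$, $f\mapsto f|_X$, is not onto), then $$C(X)^\sim=\operatorname{span}\{\delta_x : x\in X\}=c_{00}(X)=C(X)^\sim_c,$$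 where $c_{00}(X)$ is identified with a space of functionals through the map $a\mapsto\sum_{x\in X}a(x)\,\delta_x$. This map is linear, injective, has range $\operatorname{span}\{\delta_x : x\in X\}$, and satisfies $a\le b$ pointwise if and only if $\sum_x a(x) f(x)\le\sum_x b(x) f(x)$ for all $0\le f\in C(X)$. -/

import Mathlib

universe u

/-- A P-space: the intersection of countably many open sets is open. -/
def IsPSpace (X : Type u) [TopologicalSpace X] : Prop :=
  ∀ U : ℕ → Set X, (∀ n, IsOpen (U n)) → IsOpen (⋂ n, U n)

/-- Realcompactness: for no Tychonoff space `Y` containing `X` as a proper dense subspace is the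
restriction map `C(Y) → C(X)` onto. A Hausdorff space with a dense subset of the size of `X` has at
most `2 ^ 2 ^ |X|` points, so it is enough to let `Y` range over the universe of `X`. -/
def IsRealcompact (X : Type u) [TopologicalSpace X] : Prop :=
  ∀ (Y : Type u) [TopologicalSpace Y] [T35Space Y] (e : C(X, Y)),
    IsDenseEmbedding e → ¬ Function.Surjective e →
      ¬ Function.Surjective (fun f : C(Y, ℝ) => f.comp e)

section VectorLattice

variable {E : Type u} [AddCommGroup E] [Lattice E] [Module ℝ E]

/-- A linear functional is order bounded if it maps order intervals to bounded sets. -/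
def IsOrderBounded (φ : E →ₗ[ℝ] ℝ) : Prop :=
  ∀ a b : E, ∃ M : ℝ, ∀ u ∈ Set.Icc a b, |φ u| ≤ M

/-- `y n ↓ 0`. -/
def DecreasesToZero (y : ℕ → E) : Prop :=
  Antitone y ∧ IsGLB (Set.range y) 0

/-- The sequence `u` converges in order to `0`. -/
def OrderConvergesToZero (u : ℕ → E) : Prop :=
  ∃ y : ℕ → E, DecreasesToZero y ∧ ∀ n, |u n| ≤ y n

/-- A linear functional is σ-order continuous if it maps sequences converging in order to `0` to
null sequences. -/
def IsSigmaOrderContinuous (φ : E →ₗ[ℝ] ℝ) : Prop :=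
  ∀ u : ℕ → E, OrderConvergesToZero u →
    Filter.Tendsto (fun n => φ (u n)) Filter.atTop (nhds 0)

variable (E)

/-- The order dual of `E`: all order bounded linear functionals. -/
def orderBoundedDual : Submodule ℝ (E →ₗ[ℝ] ℝ) where
  carrier := {φ | IsOrderBounded φ}
  zero_mem' := fun _ _ => ⟨0, fun _ _ => by simp⟩
  add_mem' := by
    intro φ ψ hφ hψ a b
    obtain ⟨M, hM⟩ := hφ a b
    obtain ⟨N, hN⟩ := hψ a b
    exact ⟨M + N, fun u hu => (abs_add_le _ _).trans (add_le_add (hM u hu) (hN u hu))⟩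
  smul_mem' := by
    intro c φ hφ a b
    obtain ⟨M, hM⟩ := hφ a b
    refine ⟨|c| * M, fun u hu => ?_⟩
    rw [LinearMap.smul_apply, smul_eq_mul, abs_mul]
    exact mul_le_mul_of_nonneg_left (hM u hu) (abs_nonneg c)

/-- The σ-order continuous dual of `E`: all order bounded, σ-order continuous linear
functionals. -/
def sigmaOrderContinuousDual : Submodule ℝ (E →ₗ[ℝ] ℝ) where
  carrier := {φ | φ ∈ orderBoundedDual E ∧ IsSigmaOrderContinuous φ}
  zero_mem' := ⟨Submodule.zero_mem _, fun _ _ => by simp⟩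
  add_mem' := by
    rintro φ ψ ⟨hφ, hφ'⟩ ⟨hψ, hψ'⟩
    exact ⟨Submodule.add_mem _ hφ hψ, fun u hu => by simpa using (hφ' u hu).add (hψ' u hu)⟩
  smul_mem' := by
    rintro c φ ⟨hφ, hφ'⟩
    exact ⟨Submodule.smul_mem _ c hφ, fun u hu => by simpa using (hφ' u hu).const_mul c⟩

end VectorLattice

/-- The point evaluation `δ_x` on `C(X)`. -/
def pointEval {X : Type u} [TopologicalSpace X] (x : X) : C(X, ℝ) →ₗ[ℝ] ℝ where
  toFun f := f x
  map_add' _ _ := rfl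
  map_smul' _ _ := rfl

/-- The linear map sending a finitely supported function `a` on `X`, that is, an element of
`c₀₀(X)`, to the functional `∑ x, a x • δ_x` on `C(X)`. -/
noncomputable def c00ToDual (X : Type u) [TopologicalSpace X] :
    (X →₀ ℝ) →ₗ[ℝ] (C(X, ℝ) →ₗ[ℝ] ℝ) :=
  Finsupp.linearCombination ℝ pointEval

/-!
Continuous functions on a P-space are locally constant, so the pointwise infimum or sum of a
sequence of continuous functions is continuous. Infima give the σ-order continuity of `δ_x`. Sums
show that an order bounded `φ` vanishes at all but finitely many terms of a point-finite sequence
`h n`: otherwise the multiples of `h n` at which `φ` takes the value `n` would lie in one order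
interval.

Consequently the null clopen sets of `φ` form a σ-ideal, and one cannot split off non-null clopen
pieces infinitely often. So `X` is a finite union of clopen pieces, each null or not further
divisible into two non-null ones. On an indivisible piece every continuous function is almost
everywhere constant; as a realcompact `X` is closed in `ℝ ^ C(X)`, these constants are the values
`f x` at some point `x`, so there `φ` is a multiple of `δ_x`.
-/

open Filter Topology TopologicalSpace

section PSpace

variable {X : Type u} [TopologicalSpace X]

theorem IsPSpace.isOpen_of_isGδ (hP : IsPSpace X) {s : Set X} (hs : IsGδ s) : IsOpen s := by
  obtain ⟨U, hU, rfl⟩ := isGδ_iff_eq_iInter_nat.1 hs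
  exact hP U hU

theorem IsPSpace.isClopen_iUnion (hP : IsPSpace X) {ι : Type*} [Countable ι] {A : ι → Set X}
    (hA : ∀ i, IsClopen (A i)) : IsClopen (⋃ i, A i) := by
  refine ⟨isOpen_compl_iff.1 ?_, isOpen_iUnion fun i => (hA i).isOpen⟩
  rw [Set.compl_iUnion]
  exact hP.isOpen_of_isGδ (.iInter_of_isOpen fun i => (hA i).compl.isOpen)

theorem IsPSpace.isLocallyConstant (hP : IsPSpace X) {Z : Type*} [TopologicalSpace Z]
    [FirstCountableTopology Z] [T1Space Z] {f : X → Z} (hf : Continuous f) :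
    IsLocallyConstant f :=
  IsLocallyConstant.iff_isOpen_fiber.2 fun z =>
    hP.isOpen_of_isGδ ((IsGδ.singleton z).preimage hf)

theorem IsPSpace.continuous_comp_pi (hP : IsPSpace X) {ι Y Z : Type*} [Countable ι]
    [TopologicalSpace Y] [FirstCountableTopology Y] [T1Space Y] [TopologicalSpace Z]
    (f : ι → C(X, Y)) (F : (ι → Y) → Z) : Continuous fun x => F fun i => f i x :=
  ((hP.isLocallyConstant (continuous_pi fun i => (f i).continuous)).comp F).continuous

theorem DecreasesToZero.tendsto_apply (hP : IsPSpace X) {y : ℕ → C(X, ℝ)}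
    (hy : DecreasesToZero y) (x : X) : Tendsto (fun n => y n x) atTop (𝓝 0) := by
  have hnonneg : ∀ n z, 0 ≤ y n z := fun n z => hy.2.1 ⟨n, rfl⟩ z
  have hbdd : ∀ z, BddBelow (Set.range fun n => y n z) := fun z =>
    ⟨0, Set.forall_mem_range.2 fun n => hnonneg n z⟩
  let g : C(X, ℝ) := ⟨fun z => ⨅ n, y n z, hP.continuous_comp_pi y iInf⟩
  have hg : g ≤ 0 := hy.2.2 (Set.forall_mem_range.2 fun n z => ciInf_le (hbdd z) n)
  have hgx : ⨅ n, y n x = 0 := le_antisymm (hg x) (le_ciInf fun n => hnonneg n x)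
  exact hgx ▸ tendsto_atTop_ciInf (fun _ _ hmn => hy.1 hmn x) (hbdd x)

theorem isOrderBounded_pointEval (x : X) : IsOrderBounded (pointEval x) := fun a b =>
  ⟨max |a x| |b x|, fun _ hu => abs_le_max_abs_abs (hu.1 x) (hu.2 x)⟩

theorem pointEval_mem_sigmaOrderContinuousDual (hP : IsPSpace X) (x : X) :
    pointEval x ∈ sigmaOrderContinuousDual C(X, ℝ) :=
  ⟨isOrderBounded_pointEval x, fun _ ⟨_, hy, huy⟩ =>
    squeeze_zero_norm (fun n => huy n x) (hy.tendsto_apply hP x)⟩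

theorem IsOrderBounded.eventually_map_eq_zero (hP : IsPSpace X) {φ : C(X, ℝ) →ₗ[ℝ] ℝ}
    (hφ : IsOrderBounded φ) (h : ℕ → C(X, ℝ)) (hfin : ∀ x, {n | h n x ≠ 0}.Finite) :
    ∀ᶠ n in atTop, φ (h n) = 0 := by
  let k : ℕ → C(X, ℝ) := fun n => (n / φ (h n)) • h n
  let g : C(X, ℝ) := ⟨fun x => ∑' n, |k n x|, hP.continuous_comp_pi k fun v => ∑' n, |v n|⟩
  have hk : ∀ n x, |k n x| ≤ g x := fun n x =>
    have hsum : Summable fun m => |k m x| :=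
      summable_of_hasFiniteSupport <| (hfin x).subset fun m hm hmx => hm (by simp [k, hmx])
    hsum.le_tsum n fun m _ => abs_nonneg (k m x)
  obtain ⟨M, hM⟩ := hφ (-g) g
  filter_upwards [eventually_gt_atTop ⌈M⌉₊] with n hn
  by_contra hne
  have hφk : φ (k n) = n := by rw [map_smul, smul_eq_mul, div_mul_cancel₀ _ hne]
  have hle : |φ (k n)| ≤ M :=
    hM (k n) ⟨fun x => (abs_le.1 (hk n x)).1, fun x => (abs_le.1 (hk n x)).2⟩
  rw [hφk, Nat.abs_cast] at hle
  exact (Nat.lt_of_ceil_lt hn).not_ge hle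

end PSpace

section ClopenRestrict

variable {X : Type u} [TopologicalSpace X]

/-- The indicator function of a clopen set, as an element of the ring `C(X)`. -/
noncomputable def clopenIndicator (A : Clopens X) : C(X, ℝ) :=
  LocallyConstant.charFn ℝ A.isClopen

theorem clopenIndicator_apply (A : Clopens X) (x : X) :
    clopenIndicator A x = (A : Set X).indicator 1 x :=
  congrFun (LocallyConstant.coe_charFn ℝ A.isClopen) x

theorem clopenIndicator_nonneg (A : Clopens X) : 0 ≤ clopenIndicator A := fun x =>
  (Set.indicator_nonneg (fun _ _ => zero_le_one) x).trans_eq (clopenIndicator_apply A x).symm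

theorem clopenIndicator_top : clopenIndicator (⊤ : Clopens X) = 1 := by
  ext x
  simp [clopenIndicator_apply]

theorem clopenIndicator_bot : clopenIndicator (⊥ : Clopens X) = 0 := by
  ext x
  simp [clopenIndicator_apply]

theorem clopenIndicator_inf (A B : Clopens X) :
    clopenIndicator (A ⊓ B) = clopenIndicator A * clopenIndicator B := by
  ext x
  simp [clopenIndicator_apply, Set.inter_indicator_one]

theorem clopenIndicator_inf_add_sdiff (A B : Clopens X) :
    clopenIndicator (A ⊓ B) + clopenIndicator (A \ B) = clopenIndicator A := by
  ext x
  by_cases hA : x ∈ (A : Set X) <;> by_cases hB : x ∈ (B : Set X) <;>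
    simp [clopenIndicator_apply, hA, hB]

variable {φ : C(X, ℝ) →ₗ[ℝ] ℝ} {A B : Clopens X}

/-- The restriction of a functional `φ` on `C(X)` to a clopen set `A`, extended by zero off `A`.
The set `A` is null for `φ` when this functional is zero. -/
noncomputable def clopenRestrict (φ : C(X, ℝ) →ₗ[ℝ] ℝ) (A : Clopens X) : C(X, ℝ) →ₗ[ℝ] ℝ :=
  φ ∘ₗ LinearMap.mulLeft ℝ (clopenIndicator A)

theorem clopenRestrict_apply (φ : C(X, ℝ) →ₗ[ℝ] ℝ) (A : Clopens X) (f : C(X, ℝ)) :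
    clopenRestrict φ A f = φ (clopenIndicator A * f) :=
  rfl

theorem clopenRestrict_top (φ : C(X, ℝ) →ₗ[ℝ] ℝ) : clopenRestrict φ ⊤ = φ := by
  ext f
  rw [clopenRestrict_apply, clopenIndicator_top, one_mul]

theorem clopenRestrict_bot (φ : C(X, ℝ) →ₗ[ℝ] ℝ) : clopenRestrict φ ⊥ = 0 := by
  ext f
  rw [clopenRestrict_apply, clopenIndicator_bot, zero_mul, map_zero, LinearMap.zero_apply]

theorem clopenRestrict_clopenRestrict (φ : C(X, ℝ) →ₗ[ℝ] ℝ) (A B : Clopens X) :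
    clopenRestrict (clopenRestrict φ A) B = clopenRestrict φ (A ⊓ B) := by
  ext f
  simp only [clopenRestrict_apply, clopenIndicator_inf, mul_assoc]

theorem clopenRestrict_inf_add_sdiff (φ : C(X, ℝ) →ₗ[ℝ] ℝ) (A B : Clopens X) :
    clopenRestrict φ (A ⊓ B) + clopenRestrict φ (A \ B) = clopenRestrict φ A := by
  ext f
  rw [LinearMap.add_apply, clopenRestrict_apply, clopenRestrict_apply, clopenRestrict_apply,
    ← map_add, ← add_mul, clopenIndicator_inf_add_sdiff]

theorem clopenRestrict_eq_zero_of_le (hAB : A ≤ B) (hB : clopenRestrict φ B = 0) :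
    clopenRestrict φ A = 0 := by
  rw [← inf_eq_right.2 hAB, ← clopenRestrict_clopenRestrict, hB]
  rfl

theorem clopenRestrict_sup_eq_zero (hA : clopenRestrict φ A = 0) (hB : clopenRestrict φ B = 0) :
    clopenRestrict φ (A ⊔ B) = 0 := by
  rw [← clopenRestrict_inf_add_sdiff φ (A ⊔ B) A, sup_sdiff_left_self, inf_comm, inf_sup_self, hA,
    clopenRestrict_eq_zero_of_le sdiff_le hB, add_zero]

theorem clopenRestrict_partialSups_eq_zero {A : ℕ → Clopens X}
    (hA : ∀ n, clopenRestrict φ (A n) = 0) (n : ℕ) : clopenRestrict φ (partialSups A n) = 0 := by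
  induction n with
  | zero => simpa using hA 0
  | succ n ih =>
    rw [partialSups_add_one]
    exact clopenRestrict_sup_eq_zero ih (hA (n + 1))

theorem isOrderBounded_clopenRestrict (hφ : IsOrderBounded φ) (A : Clopens X) :
    IsOrderBounded (clopenRestrict φ A) := fun a b =>
  let ⟨M, hM⟩ := hφ (clopenIndicator A * a) (clopenIndicator A * b)
  ⟨M, fun u hu => hM (clopenIndicator A * u)
    ⟨mul_le_mul_of_nonneg_left hu.1 (clopenIndicator_nonneg A),
      mul_le_mul_of_nonneg_left hu.2 (clopenIndicator_nonneg A)⟩⟩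

theorem IsOrderBounded.eventually_clopenRestrict_eq_zero (hP : IsPSpace X)
    (hφ : IsOrderBounded φ) {A : ℕ → Clopens X} (hA : ∀ x, {n | x ∈ A n}.Finite) :
    ∀ᶠ n in atTop, clopenRestrict φ (A n) = 0 := by
  have hwitness : ∀ n, ∃ f, clopenRestrict φ (A n) f = 0 → clopenRestrict φ (A n) = 0 := fun n => by
    by_contra! h
    exact (h 0).2 (LinearMap.ext fun f => (h f).1)
  choose f hf using hwitness
  have hfin : ∀ x, {n | (clopenIndicator (A n) * f n) x ≠ 0}.Finite := fun x =>
    (hA x).subset fun n hn => by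
      by_contra hx
      exact hn (by simp [clopenIndicator_apply, show x ∉ (A n : Set X) from hx])
  exact (hφ.eventually_map_eq_zero hP _ hfin).mono fun n hn => hf n hn

theorem IsOrderBounded.clopenRestrict_eq_zero_of_subset_iUnion (hP : IsPSpace X)
    (hφ : IsOrderBounded φ) {A : ℕ → Clopens X} (hA : ∀ n, clopenRestrict φ (A n) = 0)
    (hB : (B : Set X) ⊆ ⋃ n, A n) : clopenRestrict φ B = 0 := by
  have hfin : ∀ x, {n | x ∈ B \ partialSups A n}.Finite := fun x => by
    by_cases hx : x ∈ B
    · obtain ⟨m, hm⟩ := Set.mem_iUnion.1 (hB hx)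
      exact (Set.finite_Iio m).subset fun n hn =>
        not_le.1 fun hmn => hn.2 (le_partialSups_of_le A hmn hm)
    · exact Set.finite_empty.subset fun n hn => hx hn.1
  obtain ⟨n, hn⟩ := (hφ.eventually_clopenRestrict_eq_zero hP hfin).exists
  rw [← clopenRestrict_inf_add_sdiff φ B (partialSups A n), hn, add_zero]
  exact clopenRestrict_eq_zero_of_le inf_le_right (clopenRestrict_partialSups_eq_zero hA n)

theorem IsOrderBounded.wellFounded_clopenRestrict_sdiff_ne_zero (hP : IsPSpace X)
    (hφ : IsOrderBounded φ) :
    WellFounded fun A B : Clopens X => A ≤ B ∧ clopenRestrict φ (B \ A) ≠ 0 := by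
  refine wellFounded_iff_isEmpty_descending_chain.2 ⟨fun ⟨A, hA⟩ => ?_⟩
  have hanti : Antitone A := antitone_nat_of_succ_le fun n => (hA n).1
  have hle : ∀ {x m n}, x ∈ A m \ A (m + 1) → x ∈ A n \ A (n + 1) → n ≤ m := fun hm hn =>
    not_lt.1 fun hmn => hm.2 (hanti hmn hn.1)
  have hfin : ∀ x, {n | x ∈ A n \ A (n + 1)}.Finite := fun x =>
    Set.Subsingleton.finite fun m hm n hn => le_antisymm (hle hn hm) (hle hm hn)
  obtain ⟨n, hn⟩ := (hφ.eventually_clopenRestrict_eq_zero hP hfin).exists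
  exact (hA n).2 hn

end ClopenRestrict

section ConullFilter

variable {X : Type u} [TopologicalSpace X] {φ : C(X, ℝ) →ₗ[ℝ] ℝ}

/-- The filter of conull sets of a functional `φ` on `C(X)`: the sets whose complement is contained
in a clopen set `N` with `φ` zero on all functions supported in `N`. -/
noncomputable def conullFilter (φ : C(X, ℝ) →ₗ[ℝ] ℝ) : Filter X :=
  .comk (fun s => ∃ N : Clopens X, s ⊆ N ∧ clopenRestrict φ N = 0)
    ⟨⊥, Set.empty_subset _, clopenRestrict_bot φ⟩
    (fun _ ⟨N, htN, hN⟩ _ hst => ⟨N, hst.trans htN, hN⟩)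
    fun _ ⟨M, hsM, hM⟩ _ ⟨N, htN, hN⟩ =>
      ⟨M ⊔ N, Set.union_subset_union hsM htN, clopenRestrict_sup_eq_zero hM hN⟩

theorem mem_conullFilter {s : Set X} :
    s ∈ conullFilter φ ↔ ∃ N : Clopens X, sᶜ ⊆ N ∧ clopenRestrict φ N = 0 :=
  Iff.rfl

theorem conullFilter_neBot (h0 : φ ≠ 0) : (conullFilter φ).NeBot := by
  refine ⟨fun hbot => h0 ?_⟩
  obtain ⟨N, hsub, hN⟩ := mem_conullFilter.1 (empty_mem_iff_bot.2 hbot)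
  rw [← clopenRestrict_top φ]
  exact clopenRestrict_eq_zero_of_le (fun x _ => hsub (Set.notMem_empty x)) hN

theorem IsOrderBounded.countableInterFilter_conullFilter (hP : IsPSpace X)
    (hφ : IsOrderBounded φ) : CountableInterFilter (conullFilter φ) := by
  refine ⟨fun S hS hmem => ?_⟩
  rcases S.eq_empty_or_nonempty with rfl | hne
  · simp
  obtain ⟨s, rfl⟩ := hS.exists_eq_range hne
  choose N hsub hN using fun n => mem_conullFilter.1 (hmem (s n) ⟨n, rfl⟩)
  refine mem_conullFilter.2 ⟨⟨⋃ n, N n, hP.isClopen_iUnion fun n => (N n).isClopen⟩, ?_,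
    hφ.clopenRestrict_eq_zero_of_subset_iUnion hP hN subset_rfl⟩
  rw [Set.sInter_range, Set.compl_iInter]
  exact Set.iUnion_mono hsub

theorem map_eq_of_eventuallyEq_conullFilter {f g : C(X, ℝ)} (hfg : f =ᶠ[conullFilter φ] g) :
    φ f = φ g := by
  obtain ⟨N, hsub, hN⟩ := mem_conullFilter.1 hfg
  have hmul : clopenIndicator N * (f - g) = f - g := by
    ext x
    by_cases hx : x ∈ (N : Set X)
    · simp [clopenIndicator_apply, hx]
    · have hfgx : f x = g x := not_not.1 fun hne => hx (hsub hne)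
      simp [hfgx]
  rw [← sub_eq_zero, ← map_sub, ← hmul, ← clopenRestrict_apply, hN, LinearMap.zero_apply]

theorem IsOrderBounded.exists_eventuallyEq_const_conullFilter (hP : IsPSpace X)
    (hφ : IsOrderBounded φ)
    (hdecide : ∀ B : Clopens X, clopenRestrict φ B = 0 ∨ clopenRestrict φ Bᶜ = 0)
    (f : C(X, ℝ)) : ∃ t : ℝ, f =ᶠ[conullFilter φ] Function.const X t := by
  have := hφ.countableInterFilter_conullFilter hP
  refine exists_eventuallyEq_const_of_forall_separating IsOpen fun U _ => ?_
  have hf : IsLocallyConstant f := hP.isLocallyConstant f.continuous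
  let B : Clopens X := ⟨f ⁻¹' U, isOpen_compl_iff.1 (hf Uᶜ), hf U⟩
  rcases hdecide B with hB | hB
  · exact .inr ⟨B, fun x hx => not_not.1 hx, hB⟩
  · exact .inl ⟨Bᶜ, subset_rfl, hB⟩

end ConullFilter

section Realcompact

variable {X : Type u} [TopologicalSpace X]

theorem exists_nonneg_eq_one_of_notMem_isClosed [CompletelyRegularSpace X] {x : X} {K : Set X}
    (hK : IsClosed K) (hx : x ∉ K) : ∃ f : C(X, ℝ), 0 ≤ f ∧ f x = 1 ∧ ∀ y ∈ K, f y = 0 := by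
  obtain ⟨f, hfx, hfK⟩ := CompletelyRegularSpace.exists_BCNN hK hx
  exact ⟨⟨fun y => f y, by fun_prop⟩, fun y => (f y).2, by simp [hfx],
    fun y hy => by simp [hfK y hy]⟩

variable (X) in
theorem isInducing_continuousMap_eval [CompletelyRegularSpace X] :
    IsInducing fun (x : X) (f : C(X, ℝ)) => f x := by
  refine isInducing_iff_nhds.2 fun x => le_antisymm ?_ fun U hU => ?_
  · exact (continuous_pi fun f : C(X, ℝ) => f.continuous).continuousAt.le_comap
  · obtain ⟨f, -, hfx, hf⟩ := exists_nonneg_eq_one_of_notMem_isClosed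
      (isOpen_interior (s := U)).isClosed_compl (not_not.2 (mem_interior_iff_mem_nhds.2 hU))
    refine ⟨{v | v f ≠ 0}, (isOpen_ne.preimage (continuous_apply f)).mem_nhds ?_, fun y hy => ?_⟩
    · simp [hfx]
    · exact interior_subset (not_not.1 fun h => hy (hf y h))

/-- Every `f : C(X)` extends to the closure of `X` in `ℝ ^ C(X)` as the `f`-th coordinate. -/
theorem IsRealcompact.isClosed_range_eval [T35Space X] (hR : IsRealcompact X) :
    IsClosed (Set.range fun (x : X) (f : C(X, ℝ)) => f x) := by
  let ev : X → C(X, ℝ) → ℝ := fun x f => f x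
  have hev : IsInducing ev := isInducing_continuousMap_eval X
  have hmem : ∀ x, ev x ∈ closure (Set.range ev) := fun x => subset_closure ⟨x, rfl⟩
  let e : C(X, closure (Set.range ev)) :=
    ⟨Set.codRestrict ev _ hmem, hev.continuous.codRestrict hmem⟩
  have hind : IsInducing e := hev.codRestrict hmem
  have hdense : DenseRange e := fun y => by
    rw [closure_subtype, ← Set.range_comp]
    exact y.2
  have hsurj : Function.Surjective e := not_not.1 fun hne =>
    hR _ e ⟨⟨hind, hdense⟩, hind.injective⟩ hne fun f =>
      ⟨⟨fun y => y.1 f, (continuous_apply f).comp continuous_subtype_val⟩, rfl⟩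
  refine isClosed_of_closure_subset fun p hp => ?_
  obtain ⟨x, hx⟩ := hsurj ⟨p, hp⟩
  exact ⟨x, congrArg Subtype.val hx⟩

end Realcompact

section OrderDual

variable {X : Type u} [TopologicalSpace X] [T35Space X] {φ : C(X, ℝ) →ₗ[ℝ] ℝ}

theorem IsOrderBounded.exists_eq_smul_pointEval (hP : IsPSpace X) (hR : IsRealcompact X)
    (hφ : IsOrderBounded φ) (h0 : φ ≠ 0)
    (hdecide : ∀ B : Clopens X, clopenRestrict φ B = 0 ∨ clopenRestrict φ Bᶜ = 0) :
    ∃ x, φ = φ 1 • pointEval x := by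
  have := conullFilter_neBot h0
  choose p hp using hφ.exists_eventuallyEq_const_conullFilter hP hdecide
  have hlim : Tendsto (fun (x : X) (f : C(X, ℝ)) => f x) (conullFilter φ) (𝓝 p) :=
    tendsto_pi_nhds.2 fun f => tendsto_const_nhds.congr' (hp f).symm
  obtain ⟨x, rfl⟩ := hR.isClosed_range_eval.mem_of_tendsto hlim
    (Eventually.of_forall fun x => ⟨x, rfl⟩)
  refine ⟨x, LinearMap.ext fun f => ?_⟩
  have hfx : f =ᶠ[conullFilter φ] ⇑(f x • (1 : C(X, ℝ))) := (hp f).trans (.of_eq (by ext; simp))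
  rw [map_eq_of_eventuallyEq_conullFilter hfx, map_smul, LinearMap.smul_apply, smul_eq_mul,
    smul_eq_mul, mul_comm]
  rfl

theorem IsOrderBounded.clopenRestrict_mem_span_pointEval (hP : IsPSpace X) (hR : IsRealcompact X)
    (hφ : IsOrderBounded φ) (A : Clopens X) :
    clopenRestrict φ A ∈ Submodule.span ℝ (Set.range (pointEval (X := X))) := by
  induction A using (hφ.wellFounded_clopenRestrict_sdiff_ne_zero hP).induction with
  | _ A ih
  by_cases hA : clopenRestrict φ A = 0
  · exact hA ▸ Submodule.zero_mem _
  by_cases hsplit : ∃ B, clopenRestrict φ (A ⊓ B) ≠ 0 ∧ clopenRestrict φ (A \ B) ≠ 0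
  · obtain ⟨B, hinf, hsdiff⟩ := hsplit
    rw [← clopenRestrict_inf_add_sdiff φ A B]
    exact Submodule.add_mem _ (ih (A ⊓ B) ⟨inf_le_left, by rwa [sdiff_inf_self_left]⟩)
      (ih (A \ B) ⟨sdiff_le, by rwa [sdiff_sdiff_right_self]⟩)
  · have hdecide : ∀ B, clopenRestrict (clopenRestrict φ A) B = 0 ∨
        clopenRestrict (clopenRestrict φ A) Bᶜ = 0 := fun B => by
      rw [clopenRestrict_clopenRestrict, clopenRestrict_clopenRestrict, ← sdiff_eq]
      by_contra! h
      exact hsplit ⟨B, h⟩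
    obtain ⟨x, hx⟩ := (isOrderBounded_clopenRestrict hφ A).exists_eq_smul_pointEval hP hR hA hdecide
    rw [hx]
    exact Submodule.smul_mem _ _ (Submodule.subset_span ⟨x, rfl⟩)

theorem IsOrderBounded.mem_span_pointEval (hP : IsPSpace X) (hR : IsRealcompact X)
    (hφ : IsOrderBounded φ) : φ ∈ Submodule.span ℝ (Set.range (pointEval (X := X))) :=
  clopenRestrict_top φ ▸ hφ.clopenRestrict_mem_span_pointEval hP hR ⊤

end OrderDual

section FinitelySupported

variable {X : Type u} [TopologicalSpace X]

theorem c00ToDual_apply (a : X →₀ ℝ) (f : C(X, ℝ)) :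
    c00ToDual X a f = a.sum fun x c => c * f x := by
  simp [c00ToDual, Finsupp.linearCombination_apply, Finsupp.sum, LinearMap.sum_apply, pointEval]

variable [T35Space X]

theorem exists_nonneg_c00ToDual_eq_apply (a : X →₀ ℝ) (x : X) :
    ∃ f : C(X, ℝ), 0 ≤ f ∧ c00ToDual X a f = a x := by
  classical
  obtain ⟨f, hf, hfx, hfa⟩ := exists_nonneg_eq_one_of_notMem_isClosed (x := x)
    (a.support.erase x).finite_toSet.isClosed (by simp)
  refine ⟨f, hf, ?_⟩
  rw [c00ToDual_apply, Finsupp.sum, Finset.sum_eq_single x, hfx, mul_one]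
  · exact fun y hy hyx => by rw [hfa y (by simpa [hyx] using hy), mul_zero]
  · exact fun hx => by rw [Finsupp.notMem_support_iff.1 hx, zero_mul]

theorem c00ToDual_le_iff (a b : X →₀ ℝ) :
    (∀ f : C(X, ℝ), 0 ≤ f → c00ToDual X a f ≤ c00ToDual X b f) ↔ a ≤ b := by
  refine ⟨fun h x => ?_, fun h f hf => ?_⟩
  · obtain ⟨f, hf, hfx⟩ := exists_nonneg_c00ToDual_eq_apply (b - a) x
    rw [← sub_nonneg, ← Finsupp.sub_apply, ← hfx, map_sub]
    exact sub_nonneg.2 (h f hf)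
  · rw [← sub_nonneg, ← LinearMap.sub_apply, ← map_sub, c00ToDual_apply]
    exact Finset.sum_nonneg fun x _ => mul_nonneg (sub_nonneg.2 (h x)) (hf x)

theorem c00ToDual_injective : Function.Injective (c00ToDual X) := fun a b hab =>
  le_antisymm ((c00ToDual_le_iff a b).1 fun f _ => by rw [hab])
    ((c00ToDual_le_iff b a).1 fun f _ => by rw [hab])

end FinitelySupported

theorem mainTheorem4 (X : Type u) [TopologicalSpace X] [T35Space X] (hP : IsPSpace X) :
    -- each point evaluation is σ-order continuous
    (∀ x : X, (pointEval x : C(X, ℝ) →ₗ[ℝ] ℝ) ∈ sigmaOrderContinuousDual C(X, ℝ)) ∧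
    (IsRealcompact X →
      orderBoundedDual C(X, ℝ) = Submodule.span ℝ (Set.range (pointEval (X := X))) ∧
      -- the span of the point evaluations is `c₀₀(X)`, as an ordered vector space
      (Function.Injective (c00ToDual X) ∧
        LinearMap.range (c00ToDual X) = Submodule.span ℝ (Set.range (pointEval (X := X))) ∧
        ∀ a b : X →₀ ℝ, (∀ f : C(X, ℝ), 0 ≤ f → c00ToDual X a f ≤ c00ToDual X b f) ↔ a ≤ b) ∧
      Submodule.span ℝ (Set.range (pointEval (X := X))) = sigmaOrderContinuousDual C(X, ℝ)) := by
  refine ⟨pointEval_mem_sigmaOrderContinuousDual hP, fun hR => ?_⟩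
  have bounded_le_span :
      orderBoundedDual C(X, ℝ) ≤ Submodule.span ℝ (Set.range (pointEval (X := X))) :=
    fun _ hφ => IsOrderBounded.mem_span_pointEval hP hR hφ
  have span_le_sigma :
      Submodule.span ℝ (Set.range (pointEval (X := X))) ≤ sigmaOrderContinuousDual C(X, ℝ) :=
    Submodule.span_le.2 (Set.range_subset_iff.2 (pointEval_mem_sigmaOrderContinuousDual hP))
  have sigma_le_bounded : sigmaOrderContinuousDual C(X, ℝ) ≤ orderBoundedDual C(X, ℝ) :=
    fun _ hφ => hφ.1
  exact ⟨le_antisymm bounded_le_span (span_le_sigma.trans sigma_le_bounded),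
    ⟨c00ToDual_injective, Finsupp.range_linearCombination ℝ, c00ToDual_le_iff⟩,
    le_antisymm span_le_sigma (sigma_le_bounded.trans bounded_le_span)⟩
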